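/- Fix integers $d\ge 1$ and $W\ge 1$. A real sequence $y=(y_n)_{n\ge0}$ is called rational of degree at most $d$ if $\sum_{n\ge0}y_nz^n=p(z)/q(z)$ with real polynomials $p,q$ of degree at most $d$ and $q(0)\ne0$. A parameter vector $\pi=(y_0,\dots,y_d,q_1,\dots,q_d)\in\mathbb R^{2d+1}$ generates the sequence $y=y(\pi)$ with first terms $y_0,\dots,y_d$ and $$y_n+q_1y_{n-1}+\cdots+q_dy_{n-d}=0\qquad(n\ge d+1).$$ The $W$-block window sums of a sequence $y$ are $\mathcal W(y)_k=\sum_{j=0}^{W-1}y_{Wk+j}$, $k\ge0$. Let $$F_{d,W}:\mathbb R^{2d+1}\to\mathbb R^{2d+1},\quad F_{d,W}(\pi)=(\mathcal W(y(\pi))_0,\dots,\mathcal W(y(\pi))_{2d}),\qquad \Omega_{d,W}=\{\pi:\det DF_{d,W}(\pi)\neq0\},$$ where $DF_{d,W}(\pi)$ is the Jacobian matrix. Say that a real sequence $(S_k)_{k\ge0}$ satisfies (H) with exponents $\mu_1,\dots,\mu_d\in\mathbb C$ and amplitudes $A_1,\dots,A_d\in\mathbb C$ if $S_k=\sum_{i=1}^dA_i\mu_i^k$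 for all $k\ge0$, the $\mu_i$ are distinct and nonzero, the $A_i$ are nonzero, and the Hankel matrix $(S_{i+j})_{0\le i,j\le d-1}$ is invertible. **Theorem.** For every $d\ge1$ and $W\ge1$ the following hold. 1. $\Omega_{d,W}$ is nonempty. In fact, for all distinct $\alpha_1,\dots,\alpha_d\in(0,1)$ there is a $\pi\in\Omega_{d,W}$ that generates $y_n=\sum_{i=1}^d\alpha_i^n$ $(n\ge0)$, and the window sums of this sequence satisfy (H) with $\mu_i=\alpha_i^W$ and $A_i=(1-\alpha_i^W)/(1-\alpha_i)$; in particular their $d\times d$ Hankel matrix is nonsingular. 2. $\det DF_{d,W}$ is a polynomial in $\pi$ that is not the zero polynomial; thus $\Omega_{d,W}$ is Zariski open, and it is open and dense in $\mathbb R^{2d+1}$. 3. (Local uniqueness.) For every $\pi\in\Omega_{d,W}$ and every $K\ge2d+1$ there is a neighbourhood $U$ of $\pi$ such that any two parameter vectors in $U$ whose generated sequences have the same first $K$ window sums are equal, and hence generate the same sequence. 4. (Global recovery of the window sums.) Let $y$ be rational of degree at most $d$, with window sums $S_k=\mathcal W(y)_k$ that satisfy (H) with $(\mu_i),(A_i)$.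 Then $(S_k)$ satisfies the linear recurrence of order $d$ with characteristic polynomial $\chi(t)=\prod_{i=1}^d(t-\mu_i)$. Let also $y'$ be rational of degree at most $d$, with window sums $S'_k$ that satisfy (H) with $(\mu_i'),(A_i')$, and let $S_k=S'_k$ for all $k<K$, where $K\ge2d$. Then $\prod_i(t-\mu_i)=\prod_i(t-\mu'_i)$; there is a permutation $\sigma$ with $\mu'_i=\mu_{\sigma(i)}$ and $A'_i=A_{\sigma(i)}$ for all $i$; $S_k=S_k'$ for all $k\ge0$; and if both tuples of exponents are listed in increasing order with respect to the same strict order relation on $\mathbb C$ (not necessarily total), then $\mu_i=\mu_i'$ and $A_i=A_i'$ for all $i$. -/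

import Mathlib

namespace WindowSums

/-- The real sequence `y` is rational of degree at most `d`: its generating function
`θ(z) = ∑ yₙ zⁿ` equals `p(z) / q(z)` with `deg p ≤ d`, `deg q ≤ d` and `q(0) ≠ 0`. -/
def IsRational (d : ℕ) (y : ℕ → ℝ) : Prop :=
  ∃ p q : Polynomial ℝ, p.natDegree ≤ d ∧ q.natDegree ≤ d ∧ q.coeff 0 ≠ 0 ∧
    (q : PowerSeries ℝ) * PowerSeries.mk y = (p : PowerSeries ℝ)

/-- The signal generated by the parameter vector `π = (y₀, …, y_d, q₁, …, q_d) ∈ ℝ^{2d+1}`: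
its first `d + 1` terms are `y₀, …, y_d`, and
`yₙ + q₁ yₙ₋₁ + ⋯ + q_d yₙ₋d = 0` for `n ≥ d + 1`. In the sum below `j` stands for the index
`j + 1` of `q`, which is the coordinate number `d + 1 + j` of `π`. -/
noncomputable def signal (d : ℕ) (π : Fin (2 * d + 1) → ℝ) (n : ℕ) : ℝ :=
  if h : n ≤ d then π ⟨n, by omega⟩
  else -∑ j : Fin d, π ⟨d + 1 + j, by omega⟩ * signal d π (n - (j + 1))
termination_by n
decreasing_by omega

theorem signal_of_le {d : ℕ} (π : Fin (2 * d + 1) → ℝ) {n : ℕ} (h : n ≤ d) :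
    signal d π n = π ⟨n, by omega⟩ := by
  rw [signal, dif_pos h]

theorem signal_of_gt {d : ℕ} (π : Fin (2 * d + 1) → ℝ) {n : ℕ} (h : d < n) :
    signal d π n = -∑ j : Fin d, π ⟨d + 1 + j, by omega⟩ * signal d π (n - (j + 1)) := by
  rw [signal, dif_neg (by omega)]

/-- The `k`-th `W`-block window sum `∑_{j < W} y_{W k + j}`. -/
noncomputable def windowSum (W : ℕ) (y : ℕ → ℝ) (k : ℕ) : ℝ :=
  ∑ j ∈ Finset.range W, y (W * k + j)

/-- The first `K` window sums of the signal generated by `π`. -/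
noncomputable def windowMap (d W K : ℕ) (π : Fin (2 * d + 1) → ℝ) : Fin K → ℝ :=
  fun k => windowSum W (signal d π) k

/-- The truncated window map `F_{d,W} : ℝ^{2d+1} → ℝ^{2d+1}`. -/
noncomputable def truncatedWindowMap (d W : ℕ) (π : Fin (2 * d + 1) → ℝ) :
    Fin (2 * d + 1) → ℝ :=
  windowMap d W (2 * d + 1) π

/-- The Jacobian matrix `DF_{d,W}(π)`. -/
noncomputable def jacobian (d W : ℕ) (π : Fin (2 * d + 1) → ℝ) :
    Matrix (Fin (2 * d + 1)) (Fin (2 * d + 1)) ℝ :=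
  LinearMap.toMatrix' (fderiv ℝ (truncatedWindowMap d W) π : (Fin (2 * d + 1) → ℝ) →ₗ[ℝ] _)

/-- The identifiability locus `Ω_{d,W}`. -/
def identLocus (d W : ℕ) : Set (Fin (2 * d + 1) → ℝ) :=
  {π | (jacobian d W π).det ≠ 0}

/-- The Hankel matrix `(S_{i+j})`, `0 ≤ i, j ≤ d - 1`. -/
def hankel (d : ℕ) (S : ℕ → ℝ) : Matrix (Fin d) (Fin d) ℝ :=
  Matrix.of fun i j => S (i + j)

/-- The real sequence `S` has the exponential-sum representation `S_k = ∑ A_i μ_i^k`, with (real or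
complex) exponents and amplitudes that satisfy the Prony nondegeneracy conditions. -/
structure IsProny (d : ℕ) (S : ℕ → ℝ) (μ A : Fin d → ℂ) : Prop where
  eq_sum : ∀ k, (S k : ℂ) = ∑ i, A i * μ i ^ k
  distinct : Function.Injective μ
  exponent_ne_zero : ∀ i, μ i ≠ 0
  amplitude_ne_zero : ∀ i, A i ≠ 0
  hankel_det_ne_zero : (hankel d S).det ≠ 0

end WindowSums

/-! Everything local reduces to one nonzero value of the Jacobian determinant. Each window sum is a
polynomial in `π`, hence so is the determinant; if it is nonzero somewhere, its nonvanishing locus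
is open and dense, and the inverse function theorem gives local uniqueness there.

The nonzero value is found at `∑ αᵢⁿ` (`expSumParam_mem_identLocus`). This sequence lies in the
family `c [n = 0] + ∑ aᵢ αᵢⁿ`, which has 2d+1 parameters. If `w` is a left null vector of the
Jacobian, put `P(t) = ∑ w_k t^k` and `g(x) = (1 + ⋯ + x^(W-1)) P(x^W)`. On the family, `w` pairs
with the window sums to `w₀ c + ∑ aᵢ g(αᵢ)`. Its derivatives in `c`, `aᵢ`, `αᵢ` must vanish, so `P`
has a root at 0 and double roots at the `αᵢ^W`: too many for degree at most 2d, whence `w = 0`.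

Global recovery is Prony's method: the invertible Hankel matrix determines the characteristic
polynomial (`IsProny.charpoly_unique`), its roots are the exponents, and a Vandermonde system
determines the amplitudes. -/

namespace WindowSums

/-! ### Polynomial dependence on the parameters, density, and local injectivity. -/

/-- The Fréchet derivative of a multivariate polynomial function. -/
theorem hasFDerivAt_mvPolynomial_eval {ι : Type*} [Fintype ι] (p : MvPolynomial ι ℝ) (x : ι → ℝ) :
    HasFDerivAt (fun x => MvPolynomial.eval x p)
      (∑ i, MvPolynomial.eval x (MvPolynomial.pderiv i p) •
        (ContinuousLinearMap.proj i : (ι → ℝ) →L[ℝ] ℝ)) x := by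
  classical
  induction p using MvPolynomial.induction_on with
  | C a => simpa using hasFDerivAt_const a x
  | add p q hp hq =>
    simp only [map_add, add_smul, Finset.sum_add_distrib]
    exact hp.add hq
  | mul_X p j hp =>
    have h := hp.mul ((ContinuousLinearMap.proj j : (ι → ℝ) →L[ℝ] ℝ).hasFDerivAt (x := x))
    simp only [map_mul, MvPolynomial.eval_X]
    refine h.congr_fderiv ?_
    ext v
    simp [Derivation.leibniz, MvPolynomial.pderiv_X, Pi.single_apply, add_mul,
      Finset.sum_add_distrib, Finset.mul_sum, mul_assoc, apply_ite (MvPolynomial.eval x)]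

theorem analyticOnNhd_mvPolynomial_eval {ι : Type*} [Fintype ι] (p : MvPolynomial ι ℝ) :
    AnalyticOnNhd ℝ (fun x : ι → ℝ => MvPolynomial.eval x p) Set.univ :=
  AnalyticOnNhd.eval_continuousLinearMap (ContinuousLinearMap.id ℝ (ι → ℝ)) p

/-- The nonvanishing locus of a nonzero real polynomial is dense. -/
theorem dense_mvPolynomial_eval_ne_zero {ι : Type*} [Fintype ι] {p : MvPolynomial ι ℝ}
    (hp : p ≠ 0) : Dense {x : ι → ℝ | MvPolynomial.eval x p ≠ 0} := by
  rw [← Set.compl_ofPred, ← interior_eq_empty_iff_dense_compl, Set.eq_empty_iff_forall_notMem]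
  intro x hx
  -- A polynomial vanishing near `x` vanishes everywhere, by the identity theorem for analytic
  -- functions.
  refine hp (MvPolynomial.funext fun y => ?_)
  have h := (analyticOnNhd_mvPolynomial_eval p).eq_of_eventuallyEq
    (g := fun _ => 0) (fun _ _ => analyticAt_const) (z₀ := x) (mem_interior_iff_mem_nhds.1 hx)
  simpa using congrFun h y

theorem exists_signal_eq_eval (d n : ℕ) : ∃ p : MvPolynomial (Fin (2 * d + 1)) ℝ,
    ∀ π, signal d π n = MvPolynomial.eval π p := by
  induction n using Nat.strong_induction_on with
  | _ n ih =>
    by_cases h : n ≤ d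
    · exact ⟨MvPolynomial.X ⟨n, by omega⟩, fun π => by simp [signal_of_le π h]⟩
    · choose! p hp using ih
      refine ⟨-∑ j : Fin d, MvPolynomial.X ⟨d + 1 + j, by omega⟩ * p (n - (j + 1)), fun π => ?_⟩
      rw [signal_of_gt π (not_le.1 h)]
      simp only [map_neg, map_sum, map_mul, MvPolynomial.eval_X]
      congr 1
      exact Finset.sum_congr rfl fun j _ => by rw [hp _ (by omega)]

theorem exists_windowSum_eq_eval (d W k : ℕ) : ∃ p : MvPolynomial (Fin (2 * d + 1)) ℝ,
    ∀ π, windowSum W (signal d π) k = MvPolynomial.eval π p := by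
  choose p hp using exists_signal_eq_eval d
  exact ⟨∑ j ∈ Finset.range W, p (W * k + j), fun π => by simp [windowSum, hp]⟩

theorem exists_truncatedWindowMap_eq_eval (d W : ℕ) :
    ∃ p : Fin (2 * d + 1) → MvPolynomial (Fin (2 * d + 1)) ℝ,
      truncatedWindowMap d W = fun π k => MvPolynomial.eval π (p k) := by
  choose p hp using exists_windowSum_eq_eval d W
  exact ⟨fun k => p k, funext fun π => funext fun k => hp k π⟩

theorem exists_det_jacobian_eq_eval (d W : ℕ) : ∃ P : MvPolynomial (Fin (2 * d + 1)) ℝ,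
    ∀ π, (jacobian d W π).det = MvPolynomial.eval π P := by
  obtain ⟨p, hp⟩ := exists_truncatedWindowMap_eq_eval d W
  refine ⟨(Matrix.of fun k l => MvPolynomial.pderiv l (p k)).det, fun π => ?_⟩
  rw [RingHom.map_det]
  congr 1
  ext k l
  have h := hasFDerivAt_pi.2 fun k => hasFDerivAt_mvPolynomial_eval (p k) π
  rw [jacobian, hp, h.fderiv]
  simp [LinearMap.toMatrix'_apply, Pi.single_apply]

theorem contDiff_truncatedWindowMap (d W : ℕ) : ContDiff ℝ 1 (truncatedWindowMap d W) := by
  obtain ⟨p, hp⟩ := exists_truncatedWindowMap_eq_eval d W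
  rw [hp, contDiff_pi]
  exact fun k => (analyticOnNhd_mvPolynomial_eval (p k)).contDiff

theorem jacobian_mulVec (d W : ℕ) (π v : Fin (2 * d + 1) → ℝ) :
    (jacobian d W π).mulVec v = fderiv ℝ (truncatedWindowMap d W) π v := by
  rw [jacobian, LinearMap.toMatrix'_mulVec]
  rfl

/-- The inverse function theorem on the identifiability locus. -/
theorem exists_nhds_injOn_truncatedWindowMap {d W : ℕ} {π : Fin (2 * d + 1) → ℝ}
    (hπ : π ∈ identLocus d W) : ∃ U ∈ nhds π, Set.InjOn (truncatedWindowMap d W) U := by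
  have hinj : Function.Injective (fderiv ℝ (truncatedWindowMap d W) π) := by
    refine (injective_iff_map_eq_zero _).2 fun v hv => ?_
    rw [← jacobian_mulVec] at hv
    exact Matrix.eq_zero_of_mulVec_eq_zero hπ hv
  let e := (LinearEquiv.ofInjectiveEndo
    (fderiv ℝ (truncatedWindowMap d W) π : (Fin (2 * d + 1) → ℝ) →ₗ[ℝ] _)
      hinj).toContinuousLinearEquiv
  have he : (e : (Fin (2 * d + 1) → ℝ) →L[ℝ] _) = fderiv ℝ (truncatedWindowMap d W) π := by
    ext v; rfl
  have h : HasStrictFDerivAt (truncatedWindowMap d W)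
      (e : (Fin (2 * d + 1) → ℝ) →L[ℝ] _) π := by
    rw [he]
    exact (contDiff_truncatedWindowMap d W).contDiffAt.hasStrictFDerivAt one_ne_zero
  refine ⟨_, h.eventually_left_inverse, fun x hx y hy hxy => ?_⟩
  rw [← show _ = x from hx, ← show _ = y from hy, hxy]

theorem exists_nhds_windowMap_injective {d W : ℕ} {π : Fin (2 * d + 1) → ℝ}
    (hπ : π ∈ identLocus d W) {K : ℕ} (hK : 2 * d + 1 ≤ K) :
    ∃ U ∈ nhds π, ∀ π₁ ∈ U, ∀ π₂ ∈ U, windowMap d W K π₁ = windowMap d W K π₂ → π₁ = π₂ := by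
  obtain ⟨U, hU, hinj⟩ := exists_nhds_injOn_truncatedWindowMap hπ
  refine ⟨U, hU, fun π₁ h₁ π₂ h₂ h => hinj h₁ h₂ (funext fun k => ?_)⟩
  exact congrFun h ⟨k, by omega⟩

end WindowSums

/-! ### Prony recovery of exponents and amplitudes. -/

namespace WindowSums

open Polynomial

/-- With `χ = ∏ (X - μᵢ)`, the sum regroups as `∑ Aᵢ μᵢ^k χ(μᵢ)`, and each `χ(μᵢ)` is zero. -/
theorem IsProny.sum_coeff_mul_eq_zero {d : ℕ} {S : ℕ → ℝ} {μ A : Fin d → ℂ}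
    (h : IsProny d S μ A) (k : ℕ) :
    ∑ m ∈ Finset.range (d + 1), (∏ i, (X - C (μ i))).coeff m * (S (k + m) : ℂ) = 0 := by
  have hdeg : (∏ i, (X - C (μ i))).natDegree < d + 1 := by
    simp [natDegree_finsetProd_X_sub_C_eq_card]
  simp_rw [h.eq_sum, Finset.mul_sum]
  rw [Finset.sum_comm]
  refine Finset.sum_eq_zero fun i _ => ?_
  have h0 : (∏ i, (X - C (μ i))).eval (μ i) = 0 := by
    rw [eval_prod, Finset.prod_eq_zero (Finset.mem_univ i) (by simp)]
  rw [eval_eq_sum_range' hdeg] at h0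
  calc _ = A i * μ i ^ k * ∑ m ∈ Finset.range (d + 1),
        (∏ i, (X - C (μ i))).coeff m * μ i ^ m := by
        rw [Finset.mul_sum]
        exact Finset.sum_congr rfl fun m _ => by ring
    _ = 0 := by rw [h0, mul_zero]

/-- The characteristic polynomial is determined by the first `2 d` terms. -/
theorem IsProny.charpoly_unique {d : ℕ} {S S' : ℕ → ℝ} {μ A μ' A' : Fin d → ℂ}
    (h : IsProny d S μ A) (h' : IsProny d S' μ' A') (hS : ∀ k < 2 * d, S k = S' k) :
    ∏ i, (X - C (μ i)) = ∏ i, (X - C (μ' i)) := by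
  have hlead (ν : Fin d → ℂ) : (∏ i, (X - C (ν i))).coeff d = 1 := by
    have := monic_prod_X_sub_C ν Finset.univ
    rwa [Monic, leadingCoeff, natDegree_finsetProd_X_sub_C_eq_card, Finset.card_univ,
      Fintype.card_fin] at this
  have hlarge (ν : Fin d → ℂ) {m : ℕ} (hm : d < m) : (∏ i, (X - C (ν i))).coeff m = 0 :=
    coeff_eq_zero_of_natDegree_lt (by simpa [natDegree_finsetProd_X_sub_C_eq_card])
  have hdet : ((hankel d S).map Complex.ofRealHom).det ≠ 0 := by
    rw [← RingHom.mapMatrix_apply, ← RingHom.map_det]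
    simpa using h.hankel_det_ne_zero
  -- Both polynomials are monic, so subtracting the two recurrences cancels the terms at `k + d` and
  -- leaves a Hankel kernel vector. Rows `k < d` involve only indices up to `2d - 1`.
  have hker := Matrix.eq_zero_of_mulVec_eq_zero hdet
    (v := fun m : Fin d => (∏ i, (X - C (μ i))).coeff m - (∏ i, (X - C (μ' i))).coeff m) (by
      ext k
      have h1 := h.sum_coeff_mul_eq_zero k
      have h2 := h'.sum_coeff_mul_eq_zero k
      rw [Finset.sum_range_succ, hlead, Finset.sum_range] at h1 h2
      rw [← hS _ (by omega)] at h2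
      have h3 : ∑ i : Fin d, (∏ i, (X - C (μ' i))).coeff i * (S' (k + i) : ℂ) =
          ∑ i : Fin d, (∏ i, (X - C (μ' i))).coeff i * (S (k + i) : ℂ) :=
        Finset.sum_congr rfl fun i _ => by rw [hS _ (by omega)]
      rw [h3] at h2
      simp only [Matrix.mulVec, dotProduct, hankel, Matrix.map_apply, Matrix.of_apply,
        Complex.ofRealHom_eq_coe, Pi.zero_apply, mul_sub, Finset.sum_sub_distrib]
      simp only [mul_comm (S _ : ℂ)]
      linear_combination h1 - h2)
  ext m
  rcases lt_trichotomy m d with hm | rfl | hm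
  · exact sub_eq_zero.1 (congrFun hker ⟨m, hm⟩)
  · rw [hlead, hlead]
  · rw [hlarge _ hm, hlarge _ hm]

theorem exists_perm_of_prod_X_sub_C_eq {d : ℕ} {μ μ' : Fin d → ℂ} (hμ' : Function.Injective μ')
    (h : ∏ i, (X - C (μ i)) = ∏ i, (X - C (μ' i))) :
    ∃ σ : Equiv.Perm (Fin d), ∀ i, μ' i = μ (σ i) := by
  have hroot (i : Fin d) : ∃ j, μ' i = μ j := by
    have h0 : (∏ j, (X - C (μ j))).eval (μ' i) = 0 := by
      rw [h, eval_prod, Finset.prod_eq_zero (Finset.mem_univ i) (by simp)]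
    rw [eval_prod, Finset.prod_eq_zero_iff] at h0
    obtain ⟨j, -, hj⟩ := h0
    exact ⟨j, by simpa [sub_eq_zero] using hj⟩
  choose σ hσ using hroot
  have hinj : Function.Injective σ := fun i j hij => hμ' (by rw [hσ, hσ, hij])
  exact ⟨Equiv.ofBijective σ (Finite.injective_iff_bijective.1 hinj), hσ⟩

/-- Exponents and amplitudes are determined, up to order, by the first `2 d` terms. -/
theorem IsProny.exists_perm {d : ℕ} {S S' : ℕ → ℝ} {μ A μ' A' : Fin d → ℂ}
    (h : IsProny d S μ A) (h' : IsProny d S' μ' A') (hS : ∀ k < 2 * d, S k = S' k) :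
    ∃ σ : Equiv.Perm (Fin d), ∀ i, μ' i = μ (σ i) ∧ A' i = A (σ i) := by
  obtain ⟨σ, hσ⟩ := exists_perm_of_prod_X_sub_C_eq h'.distinct (h.charpoly_unique h' hS)
  refine ⟨σ, fun i => ⟨hσ i, ?_⟩⟩
  -- Once the exponents are matched, the amplitude differences solve a homogeneous Vandermonde
  -- system with distinct nodes `μ'`.
  have hz := Matrix.eq_zero_of_forall_pow_sum_mul_pow_eq_zero (v := fun i => A' i - A (σ i))
    h'.distinct (fun k => by
      have h1 := h.eq_sum k
      rw [hS k (by omega), h'.eq_sum, ← Equiv.sum_comp σ fun i => A i * μ i ^ (k : ℕ)] at h1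
      simp only [sub_mul, Finset.sum_sub_distrib, h1]
      simp [hσ])
  exact sub_eq_zero.1 (congrFun hz i)

theorem IsProny.eq_of_perm {d : ℕ} {S S' : ℕ → ℝ} {μ A μ' A' : Fin d → ℂ}
    (h : IsProny d S μ A) (h' : IsProny d S' μ' A') {σ : Equiv.Perm (Fin d)}
    (hσ : ∀ i, μ' i = μ (σ i) ∧ A' i = A (σ i)) (k : ℕ) : S k = S' k := by
  have : (S k : ℂ) = S' k := by
    rw [h.eq_sum, h'.eq_sum, ← Equiv.sum_comp σ]
    exact Finset.sum_congr rfl fun i _ => by rw [(hσ i).1, (hσ i).2]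
  exact_mod_cast this

/-- A permutation that matches two increasing lists is trivial. -/
theorem perm_eq_one_of_increasing {d : ℕ} {α : Type*} {r : α → α → Prop} [IsStrictOrder α r]
    {μ μ' : Fin d → α} (hμ : ∀ i j, i < j → r (μ i) (μ j)) (hμ' : ∀ i j, i < j → r (μ' i) (μ' j))
    {σ : Equiv.Perm (Fin d)} (hσ : ∀ i, μ' i = μ (σ i)) : σ = 1 := by
  have hmono : StrictMono σ := fun i j hij => by
    have hr := hμ' i j hij
    rw [hσ, hσ] at hr
    rcases lt_trichotomy (σ i) (σ j) with hlt | heq | hgt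
    · exact hlt
    · exact absurd (σ.injective heq) hij.ne
    · exact absurd (hμ _ _ hgt) (asymm hr)
  -- `Fin d` has only one order automorphism.
  have h := Subsingleton.elim (hmono.orderIsoOfSurjective σ σ.surjective) (OrderIso.refl _)
  exact Equiv.ext fun i => congrArg (fun e : Fin d ≃o Fin d => e i) h

end WindowSums

/-! ### Exponential sums as points of the identifiability locus. -/

namespace WindowSums

open Polynomial

/-- The parameter vector of the sequence `c [n = 0] + ∑ aᵢ αᵢⁿ`. -/
noncomputable def expSumParam (d : ℕ) (c : ℝ) (a α : Fin d → ℝ) : Fin (2 * d + 1) → ℝ :=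
  fun m => if (m : ℕ) ≤ d then (if (m : ℕ) = 0 then c else 0) + ∑ i, a i * α i ^ (m : ℕ)
    -- At `m = d + 1 + j` this is the coefficient of `X^(d-1-j)`, which is `q_{j+1}`.
    else (∏ i, (X - C (α i))).coeff (2 * d - m)

theorem sum_coeff_prod_X_sub_C_mul_pow {d : ℕ} (α : Fin d → ℝ) (i : Fin d) :
    ∑ j ∈ Finset.range d, (∏ i, (X - C (α i))).coeff j * α i ^ j = -α i ^ d := by
  have hdeg : (∏ i, (X - C (α i))).natDegree = d := by
    simp [natDegree_finsetProd_X_sub_C_eq_card]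
  have h0 : (∏ i, (X - C (α i))).eval (α i) = 0 := by
    rw [eval_prod, Finset.prod_eq_zero (Finset.mem_univ i) (by simp)]
  have hlead : (∏ i, (X - C (α i))).coeff d = 1 := by
    have := monic_prod_X_sub_C α Finset.univ
    rwa [Monic, leadingCoeff, hdeg] at this
  rw [eval_eq_sum_range, hdeg, Finset.sum_range_succ, hlead] at h0
  linarith

theorem signal_expSumParam {d : ℕ} (c : ℝ) (a α : Fin d → ℝ) (n : ℕ) :
    signal d (expSumParam d c a α) n = (if n = 0 then c else 0) + ∑ i, a i * α i ^ n := by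
  induction n using Nat.strong_induction_on with
  | _ n ih =>
    by_cases h : n ≤ d
    · rw [signal_of_le _ h]
      simp [expSumParam, h]
    · obtain ⟨s, rfl⟩ : ∃ s, n = d + (s + 1) := ⟨n - d - 1, by omega⟩
      rw [signal_of_gt _ (not_le.1 h), if_neg (by omega), zero_add]
      have hterm (j : Fin d) : expSumParam d c a α ⟨d + 1 + j, by omega⟩ *
          signal d (expSumParam d c a α) (d + (s + 1) - (j + 1)) =
          ∑ i, a i * α i ^ (s + 1) *
            ((∏ i, (X - C (α i))).coeff (d - 1 - j) * α i ^ (d - 1 - (j : ℕ))) := by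
        -- For `n > d` the recurrence reaches back only to `y_{n-d}` with `n - d ≥ 1`, so the
        -- correction `c` at index 0 never enters.
        rw [ih _ (by omega), if_neg (by omega), zero_add, expSumParam, if_neg (by simp; omega),
          Finset.mul_sum]
        refine Finset.sum_congr rfl fun i _ => ?_
        rw [show 2 * d - (d + 1 + (j : ℕ)) = d - 1 - j by omega,
          show d + (s + 1) - ((j : ℕ) + 1) = (s + 1) + (d - 1 - j) by omega, pow_add]
        ring
      rw [Finset.sum_congr rfl fun j _ => hterm j, Finset.sum_comm, ← Finset.sum_neg_distrib]
      refine Finset.sum_congr rfl fun i _ => ?_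
      have hsum := sum_coeff_prod_X_sub_C_mul_pow α i
      rw [← Finset.sum_range_reflect, Finset.sum_range] at hsum
      rw [← Finset.mul_sum, hsum]
      ring

theorem windowSum_expSumParam {d W : ℕ} (hW : 1 ≤ W) (c : ℝ) (a α : Fin d → ℝ) (k : ℕ) :
    windowSum W (signal d (expSumParam d c a α)) k =
      (if k = 0 then c else 0) +
        ∑ i, a i * (∑ j ∈ Finset.range W, α i ^ j) * (α i ^ W) ^ k := by
  simp only [windowSum, signal_expSumParam, Finset.sum_add_distrib]
  congr 1
  · by_cases hk : k = 0
    · subst hk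
      simp [show W ≠ 0 by omega]
    · rw [if_neg hk]
      exact Finset.sum_eq_zero fun j _ => if_neg (by simp [hk]; omega)
  · rw [Finset.sum_comm]
    refine Finset.sum_congr rfl fun i _ => ?_
    rw [Finset.mul_sum, Finset.sum_mul]
    exact Finset.sum_congr rfl fun j _ => by rw [pow_add, pow_mul]; ring

theorem differentiable_coeff_prod_X_sub_C {ι : Type*} (s : Finset ι) {f : ι → ℝ → ℝ}
    (hf : ∀ i, Differentiable ℝ (f i)) (k : ℕ) :
    Differentiable ℝ fun t => (∏ i ∈ s, (X - C (f i t))).coeff k := by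
  classical
  induction s using Finset.induction_on generalizing k with
  | empty => simp
  | insert i s hi ih =>
    simp only [Finset.prod_insert hi, sub_mul, coeff_sub, coeff_C_mul]
    refine Differentiable.sub ?_ ((hf i).mul (ih k))
    cases k with
    | zero => simp
    | succ k => simpa only [coeff_X_mul] using ih k

theorem differentiable_expSumParam {d : ℕ} {c : ℝ → ℝ} {a α : Fin d → ℝ → ℝ}
    (hc : Differentiable ℝ c) (ha : ∀ i, Differentiable ℝ (a i))
    (hα : ∀ i, Differentiable ℝ (α i)) :
    Differentiable ℝ fun t => expSumParam d (c t) (fun i => a i t) fun i => α i t := by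
  rw [differentiable_pi]
  intro m
  simp only [expSumParam]
  split_ifs
  · fun_prop
  · fun_prop
  · exact differentiable_coeff_prod_X_sub_C _ hα _

/-- A left null vector of the Jacobian annihilates the velocity of the window sums along every
curve. -/
theorem hasDerivAt_dotProduct_truncatedWindowMap {d W : ℕ} {w : Fin (2 * d + 1) → ℝ}
    {γ : ℝ → Fin (2 * d + 1) → ℝ} {t : ℝ} (hγ : DifferentiableAt ℝ γ t)
    (hw : Matrix.vecMul w (jacobian d W (γ t)) = 0) :
    HasDerivAt (fun t => w ⬝ᵥ truncatedWindowMap d W (γ t)) 0 t := by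
  have hF : HasFDerivAt (truncatedWindowMap d W) (fderiv ℝ (truncatedWindowMap d W) (γ t)) (γ t) :=
    ((contDiff_truncatedWindowMap d W).differentiable one_ne_zero _).hasFDerivAt
  have h := hasDerivAt_pi.1 (hF.comp_hasDerivAt t hγ.hasDerivAt)
  have h' := HasDerivAt.fun_sum (u := Finset.univ) fun k _ => (h k).const_mul (w k)
  refine h'.congr_deriv ?_
  change w ⬝ᵥ (fderiv ℝ (truncatedWindowMap d W) (γ t) (deriv γ t)) = 0
  rw [← jacobian_mulVec, Matrix.dotProduct_mulVec, hw, zero_dotProduct]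

theorem dotProduct_truncatedWindowMap_expSumParam {d W : ℕ} (hW : 1 ≤ W)
    (w : Fin (2 * d + 1) → ℝ) (c : ℝ) (a α : Fin d → ℝ) :
    w ⬝ᵥ truncatedWindowMap d W (expSumParam d c a α) =
      w 0 * c + ∑ i, a i * ((∑ j ∈ Finset.range W, α i ^ j) *
        (∑ k, C (w k) * X ^ (k : ℕ) : ℝ[X]).eval (α i ^ W)) := by
  simp only [dotProduct, truncatedWindowMap, windowMap, windowSum_expSumParam hW, mul_add,
    Finset.sum_add_distrib]
  congr 1
  · rw [Finset.sum_eq_single 0]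
    · simp
    · intro k _ hk
      rw [if_neg (by simpa using hk), mul_zero]
    · simp
  · simp only [Finset.mul_sum, eval_finsetSum, eval_mul, eval_C, eval_pow, eval_X]
    rw [Finset.sum_comm]
    simp only [Finset.sum_mul, Finset.mul_sum]
    exact Finset.sum_congr rfl fun i _ => Finset.sum_congr rfl fun k _ =>
      Finset.sum_congr rfl fun j _ => by ring

/-- A polynomial of degree at most `2 d` with a root at zero and `d` further double roots
vanishes. -/
theorem eq_zero_of_double_roots {d : ℕ} {P : ℝ[X]} (hdeg : P.natDegree ≤ 2 * d)
    {β : Fin d → ℝ} (hβ : Function.Injective β) (hβ0 : ∀ i, β i ≠ 0) (h0 : P.eval 0 = 0)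
    (h1 : ∀ i, P.eval (β i) = 0) (h2 : ∀ i, (derivative P).eval (β i) = 0) : P = 0 := by
  by_contra hP
  have hsq : ∏ i, (X - C (β i)) ^ 2 ∣ P := by
    refine Fintype.prod_dvd_of_coprime (fun i j hij => ?_) fun i => ?_
    · exact (pairwise_coprime_X_sub_C hβ hij).pow
    · exact (le_rootMultiplicity_iff hP).1
        ((one_lt_rootMultiplicity_iff_isRoot hP).2 ⟨h1 i, h2 i⟩)
  have hX : X ∣ P := X_dvd_iff.2 (by rwa [coeff_zero_eq_eval_zero])
  have hcop : IsCoprime X (∏ i, (X - C (β i)) ^ 2) := by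
    refine IsCoprime.prod_right fun i _ => IsCoprime.pow_right ?_
    have := isCoprime_X_sub_C_of_isUnit_sub (a := (0 : ℝ)) (b := β i)
      (by simpa using hβ0 i)
    simpa using this
  have hle := natDegree_le_of_dvd (hcop.mul_dvd hX hsq) hP
  have hmonic : (∏ i, (X - C (β i)) ^ 2).Monic :=
    monic_prod_of_monic _ _ fun i _ => (monic_X_sub_C _).pow 2
  rw [natDegree_X_mul hmonic.ne_zero,
    natDegree_prod_of_monic _ _ fun i _ => (monic_X_sub_C _).pow 2] at hle
  -- The divisor `X ∏ (X - βᵢ)²` has degree 2d+1.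
  simp [natDegree_pow] at hle
  omega

theorem hasDerivAt_geomSum_mul_eval_pow (W : ℕ) (P : ℝ[X]) (x : ℝ) :
    HasDerivAt (fun x => (∑ j ∈ Finset.range W, x ^ j) * P.eval (x ^ W))
      ((∑ j ∈ Finset.range W, j * x ^ (j - 1)) * P.eval (x ^ W) +
        (∑ j ∈ Finset.range W, x ^ j) *
          ((derivative P).eval (x ^ W) * (W * x ^ (W - 1)))) x := by
  refine HasDerivAt.mul ?_ ((P.hasDerivAt (x ^ W)).comp x (hasDerivAt_pow W x))
  exact HasDerivAt.fun_sum fun j _ => hasDerivAt_pow j x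

theorem expSumParam_mem_identLocus {d W : ℕ} (hW : 1 ≤ W) {α : Fin d → ℝ}
    (hinj : Function.Injective α) (hpos : ∀ i, 0 < α i) :
    expSumParam d 0 1 α ∈ identLocus d W := by
  intro hdet
  obtain ⟨w, hw0, hw⟩ := Matrix.exists_vecMul_eq_zero_iff.2 hdet
  set P : ℝ[X] := ∑ k, C (w k) * X ^ (k : ℕ) with hPdef
  set g : ℝ → ℝ := fun x => (∑ j ∈ Finset.range W, x ^ j) * P.eval (x ^ W) with hg
  have hφ (i : Fin d) : 0 < ∑ j ∈ Finset.range W, α i ^ j :=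
    Finset.sum_pos (fun j _ => pow_pos (hpos i) j) (by simp; omega)
  have hgd (i : Fin d) := hasDerivAt_geomSum_mul_eval_pow W P (α i)
  -- Derivative at `t = 0` along the curve with velocity `(c, b, e)` in the family: zero by the
  -- choice of `w`, and also given by the explicit formula. The coordinate directions are then read
  -- off one by one.
  have key (c : ℝ) (b e : Fin d → ℝ) :
      w 0 * c + ∑ i, (b i * g (α i) + deriv g (α i) * e i) = 0 := by
    have hγ : Differentiable ℝ fun t : ℝ =>
        expSumParam d (t * c) (fun i => 1 + t * b i) fun i => α i + t * e i :=
      differentiable_expSumParam (by fun_prop) (fun i => by fun_prop) fun i => by fun_prop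
    have h1 := hasDerivAt_dotProduct_truncatedWindowMap (W := W) (w := w) (hγ 0)
      (by simpa [Pi.one_def] using hw)
    simp only [dotProduct_truncatedWindowMap_expSumParam hW] at h1
    have hlin (x y : ℝ) : HasDerivAt (fun t : ℝ => x + t * y) y 0 := by
      simpa using ((hasDerivAt_id (0 : ℝ)).mul_const y).const_add x
    have hgα (i : Fin d) : HasDerivAt (fun t : ℝ => g (α i + t * e i))
        (deriv g (α i) * e i) 0 := by
      have hd : HasDerivAt g (deriv g (α i)) (α i + 0 * e i) := by
        simpa using (hgd i).differentiableAt.hasDerivAt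
      exact hd.comp (0 : ℝ) (hlin (α i) (e i))
    have h2 := (((hasDerivAt_id (0 : ℝ)).mul_const c).const_mul (w 0)).add
      (HasDerivAt.fun_sum (u := Finset.univ) fun i _ => (hlin 1 (b i)).mul (hgα i))
    have h3 := h2.unique h1
    simpa using h3
  have hw00 : w 0 = 0 := by simpa using key 1 0 0
  have hgi (i : Fin d) : g (α i) = 0 := by
    simpa [hw00, Pi.single_apply] using key 0 (Pi.single i 1) 0
  have hg'i (i : Fin d) : deriv g (α i) = 0 := by
    simpa [hw00, Pi.single_apply] using key 0 0 (Pi.single i 1)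
  have hP1 (i : Fin d) : P.eval (α i ^ W) = 0 :=
    (mul_eq_zero.1 (hgi i)).resolve_left (hφ i).ne'
  have hP2 (i : Fin d) : (derivative P).eval (α i ^ W) = 0 := by
    have h := hg'i i
    rw [(hgd i).deriv, hP1, mul_zero, zero_add] at h
    -- This chain rule factor of `x ↦ x^W` must be nonzero to pass from `g' = 0` to `P' = 0`.
    have hW' : (W : ℝ) * α i ^ (W - 1) ≠ 0 :=
      mul_ne_zero (by exact_mod_cast (by omega : W ≠ 0)) (pow_ne_zero _ (hpos i).ne')
    simpa [(hφ i).ne', hW'] using h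
  have hcoeff (k : Fin (2 * d + 1)) : P.coeff k = w k := by
    simp [hPdef, finsetSum_coeff, coeff_X_pow, Fin.val_inj]
  have hP : P = 0 := by
    refine eq_zero_of_double_roots (d := d) (β := fun i => α i ^ W) ?_ ?_
      (fun i => pow_ne_zero _ (hpos i).ne') ?_ hP1 hP2
    · exact natDegree_sum_le_of_forall_le _ _ fun k _ =>
        (natDegree_C_mul_X_pow_le _ _).trans (by omega)
    · intro i j hij
      exact hinj ((pow_left_inj₀ (hpos i).le (hpos j).le (by omega)).1 hij)
    · rw [← coeff_zero_eq_eval_zero, ← hw00]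
      exact hcoeff 0
  exact hw0 (funext fun k => by rw [← hcoeff, hP]; simp)

/-- Hankel matrices of exponential sums factor through Vandermonde matrices. -/
theorem det_hankel_ne_zero {d : ℕ} {S : ℕ → ℝ} {μ A : Fin d → ℝ}
    (hS : ∀ k, S k = ∑ i, A i * μ i ^ k) (hμ : Function.Injective μ) (hA : ∀ i, A i ≠ 0) :
    (hankel d S).det ≠ 0 := by
  have h : hankel d S =
      (Matrix.vandermonde μ).transpose * (Matrix.diagonal A * Matrix.vandermonde μ) := by
    ext i j
    rw [Matrix.mul_apply]
    simp only [hankel, Matrix.of_apply, hS, Matrix.transpose_apply,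
      Matrix.diagonal_mul, Matrix.vandermonde_apply]
    exact Finset.sum_congr rfl fun k _ => by rw [pow_add]; ring
  have hV := Matrix.det_vandermonde_ne_zero_iff.2 hμ
  rw [h, Matrix.det_mul, Matrix.det_mul, Matrix.det_transpose, Matrix.det_diagonal]
  exact mul_ne_zero hV (mul_ne_zero (Finset.prod_ne_zero_iff.2 fun i _ => hA i) hV)

theorem isProny_windowSum_expSumParam {d W : ℕ} (hW : 1 ≤ W) {α : Fin d → ℝ}
    (hinj : Function.Injective α) (hα : ∀ i, α i ∈ Set.Ioo (0 : ℝ) 1) :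
    IsProny d (windowSum W (signal d (expSumParam d 0 1 α)))
      (fun i => ((α i ^ W : ℝ) : ℂ)) (fun i => (((1 - α i ^ W) / (1 - α i) : ℝ) : ℂ)) := by
  have hS (k : ℕ) : windowSum W (signal d (expSumParam d 0 1 α)) k =
      ∑ i, (1 - α i ^ W) / (1 - α i) * (α i ^ W) ^ k := by
    rw [windowSum_expSumParam hW]
    simp only [ite_self, zero_add, Pi.one_apply, one_mul]
    refine Finset.sum_congr rfl fun i _ => ?_
    rw [geom_sum_eq (hα i).2.ne, ← neg_div_neg_eq, neg_sub, neg_sub]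
  have hμ : Function.Injective fun i => α i ^ W := fun i j hij =>
    hinj ((pow_left_inj₀ (hα i).1.le (hα j).1.le (by omega)).1 hij)
  have hA (i : Fin d) : (1 - α i ^ W) / (1 - α i) ≠ 0 :=
    div_ne_zero (sub_pos.2 (pow_lt_one₀ (hα i).1.le (hα i).2 (by omega))).ne'
      (sub_pos.2 (hα i).2).ne'
  refine ⟨fun k => ?_, Complex.ofReal_injective.comp hμ, fun i => ?_, fun i => ?_,
    det_hankel_ne_zero hS hμ hA⟩
  · rw [hS]
    push_cast
    rfl
  · exact Complex.ofReal_ne_zero.2 (pow_ne_zero _ (hα i).1.ne')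
  · exact Complex.ofReal_ne_zero.2 (hA i)

end WindowSums

theorem mainTheorem7 (d W : ℕ) (hd : 1 ≤ d) (hW : 1 ≤ W) :
    -- the identifiability locus is nonempty
    (WindowSums.identLocus d W).Nonempty ∧
    -- every signal `∑ αᵢⁿ` with distinct `αᵢ ∈ (0, 1)` is a witness: its parameter vector lies in
    -- the locus, and its window sums satisfy the Prony and Hankel nondegeneracy conditions
    (∀ α : Fin d → ℝ, Function.Injective α → (∀ i, α i ∈ Set.Ioo (0 : ℝ) 1) →
      ∃ π ∈ WindowSums.identLocus d W,
        (∀ n, WindowSums.signal d π n = ∑ i, α i ^ n) ∧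
        WindowSums.IsProny d (WindowSums.windowSum W (WindowSums.signal d π))
          (fun i => ((α i ^ W : ℝ) : ℂ))
          (fun i => (((1 - α i ^ W) / (1 - α i) : ℝ) : ℂ))) ∧
    -- the locus is Zariski open, open and dense
    (∃ P : MvPolynomial (Fin (2 * d + 1)) ℝ, P ≠ 0 ∧
      ∀ π, (WindowSums.jacobian d W π).det = MvPolynomial.eval π P) ∧
    IsOpen (WindowSums.identLocus d W) ∧ Dense (WindowSums.identLocus d W) ∧
    -- local uniqueness of the parameter and of the signal on the locus, from `K ≥ 2d+1` windows
    (∀ π ∈ WindowSums.identLocus d W, ∀ K : ℕ, 2 * d + 1 ≤ K →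
      ∃ U ∈ nhds π, ∀ π₁ ∈ U, ∀ π₂ ∈ U,
        WindowSums.windowMap d W K π₁ = WindowSums.windowMap d W K π₂ →
          π₁ = π₂ ∧ WindowSums.signal d π₁ = WindowSums.signal d π₂) ∧
    -- global Prony recovery of the window-sum process, from `K ≥ 2d` windows
    (∀ (y : ℕ → ℝ) (μ A : Fin d → ℂ), WindowSums.IsRational d y →
      WindowSums.IsProny d (WindowSums.windowSum W y) μ A →
      (∀ k, ∑ m ∈ Finset.range (d + 1),
        (∏ i, (Polynomial.X - Polynomial.C (μ i))).coeff m *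
          (WindowSums.windowSum W y (k + m) : ℂ) = 0) ∧
      ∀ (y' : ℕ → ℝ) (μ' A' : Fin d → ℂ), WindowSums.IsRational d y' →
        WindowSums.IsProny d (WindowSums.windowSum W y') μ' A' →
        ∀ K : ℕ, 2 * d ≤ K →
        (∀ k < K, WindowSums.windowSum W y k = WindowSums.windowSum W y' k) →
          (∏ i, (Polynomial.X - Polynomial.C (μ i)) =
            ∏ i, (Polynomial.X - Polynomial.C (μ' i))) ∧
          (∃ σ : Equiv.Perm (Fin d), ∀ i, μ' i = μ (σ i) ∧ A' i = A (σ i)) ∧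
          (∀ k, WindowSums.windowSum W y k = WindowSums.windowSum W y' k) ∧
          (∀ r : ℂ → ℂ → Prop, IsStrictOrder ℂ r →
            (∀ i j, i < j → r (μ i) (μ j)) → (∀ i j, i < j → r (μ' i) (μ' j)) →
              μ = μ' ∧ A = A')) := by
  have hwit : ∀ α : Fin d → ℝ, Function.Injective α → (∀ i, α i ∈ Set.Ioo (0 : ℝ) 1) →
      ∃ π ∈ WindowSums.identLocus d W,
        (∀ n, WindowSums.signal d π n = ∑ i, α i ^ n) ∧
        WindowSums.IsProny d (WindowSums.windowSum W (WindowSums.signal d π))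
          (fun i => ((α i ^ W : ℝ) : ℂ))
          (fun i => (((1 - α i ^ W) / (1 - α i) : ℝ) : ℂ)) := fun α hinj hα =>
    ⟨WindowSums.expSumParam d 0 1 α,
      WindowSums.expSumParam_mem_identLocus hW hinj fun i => (hα i).1,
      fun n => by simp [WindowSums.signal_expSumParam],
      WindowSums.isProny_windowSum_expSumParam hW hinj hα⟩
  have hne : (WindowSums.identLocus d W).Nonempty := by
    -- Any distinct points of (0, 1) would do; the choice here is 1/2, 1/3, and so on.
    obtain ⟨π, hπ, -⟩ := hwit (fun i => 1 / ((i : ℝ) + 2))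
      (fun i j hij => by
        have h : (i : ℝ) + 2 = j + 2 := by simpa using hij
        exact Fin.ext (by exact_mod_cast add_right_cancel h))
      (fun i => ⟨by positivity, by
        rw [div_lt_one (by positivity)]
        linarith [Nat.cast_nonneg (α := ℝ) (i : ℕ)]⟩)
    exact ⟨π, hπ⟩
  obtain ⟨P, hP⟩ := WindowSums.exists_det_jacobian_eq_eval d W
  have hlocus : WindowSums.identLocus d W = {π | MvPolynomial.eval π P ≠ 0} := by
    ext π
    simp [WindowSums.identLocus, hP]
  have hP0 : P ≠ 0 := by
    rintro rfl
    obtain ⟨π, hπ⟩ := hne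
    simp [hlocus] at hπ
  refine ⟨hne, hwit, ⟨P, hP0, hP⟩, ?_, ?_, fun π hπ K hK => ?_,
    fun y μ A _ h => ⟨h.sum_coeff_mul_eq_zero, fun y' μ' A' _ h' K hK hS => ?_⟩⟩
  · rw [hlocus]
    exact isOpen_ne.preimage P.continuous_eval
  · rw [hlocus]
    exact WindowSums.dense_mvPolynomial_eval_ne_zero hP0
  · obtain ⟨U, hU, hinj⟩ := WindowSums.exists_nhds_windowMap_injective hπ hK
    refine ⟨U, hU, fun π₁ h₁ π₂ h₂ heq => ?_⟩
    obtain rfl := hinj π₁ h₁ π₂ h₂ heq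
    exact ⟨rfl, rfl⟩
  · have hS' : ∀ k < 2 * d, WindowSums.windowSum W y k = WindowSums.windowSum W y' k :=
      fun k hk => hS k (by omega)
    obtain ⟨σ, hσ⟩ := h.exists_perm h' hS'
    refine ⟨h.charpoly_unique h' hS', ⟨σ, hσ⟩, h.eq_of_perm h' hσ, fun r _ hμ hμ' => ?_⟩
    obtain rfl := WindowSums.perm_eq_one_of_increasing hμ hμ' fun i => (hσ i).1
    exact ⟨funext fun i => (hσ i).1.symm, funext fun i => (hσ i).2.symm⟩
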